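/- Let $P_L(a,z)\in\mathbb Z[a^{\pm1},z^{\pm1}]$ be the Jones–Conway (Homfly) polynomial of oriented links $L$ up to isotopy, i.e. the isotopy invariant determined by $P_{T_1}=1$ for the trivial knot $T_1$ and $aP_{L_+}+a^{-1}P_{L_-}=zP_{L_0}$, where $L_+,L_-,L_0$ have diagrams that are identical except in a disc, in which they show a positive crossing, a negative crossing, and its oriented smoothing, respectively. Let $k\ge 0$, and let $\bar t_{2k}(L)$, $L_0$, $L_\infty$ be oriented link diagrams that are identical except in a disc. In the disc, $L_0$ consists of two uncrossed antiparallel vertical strands; $\bar t_{2k}(L)$ consists of these two strands twisted around each other by $2k$ half twists, in each crossing of which the strand running from the bottom left to the top right is the overpass (so that all $2k$ crossings are negative); and $L_\infty$ consists of a local maximum joining the two lower end points and a local minimum joining the two upper end points. Then $$P_{\bar t_{2k}(L)}(a,z)=(-1)^k a^{2k}P_{L_0}(a,z)+z\,u_1^{(2k)}(a)\,P_{L_\infty}(a,z),$$ where $u_1^{(0)}=0$, $u_1^{(2)}=a$ and $u_1^{(2k)}=-a^2u_1^{(2k-2)}+a$ for $k\ge 1$, or equivalently, for all $k\ge 0$,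 $$u_1^{(2k)}=(-1)^{k+1}a^k\,\frac{a^k+(-1)^{k+1}a^{-k}}{a+a^{-1}}.$$ -/

import Mathlib

open scoped LaurentPolynomial

/-! ### Oriented link diagrams

Diagrams are drawn in the plane in general position with respect to the height function and are
read from bottom to top, one elementary piece (a crossing, a local minimum or a local maximum) at
a time.  A strand meeting a horizontal line is recorded by its direction there: `true` means that
it is directed upwards, `false` that it is directed downwards. -/

/-- The elementary pieces of an oriented diagram.
* `cup s` is a local minimum whose left leg has direction `s`;
* `cap s` is a local maximum whose left leg has direction `s`;
* `cross o s t` is a crossing; the strand entering at the bottom left has direction `s` and leaves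
  at the top right, the strand entering at the bottom right has direction `t` and leaves at the top
  left; the former strand is the overpass if `o = true` and the underpass if `o = false`. -/
inductive Piece : Type
  | cup (s : Bool)
  | cap (s : Bool)
  | cross (o s t : Bool)

/-- The directions of the strands at the bottom of a piece, from left to right. -/
def Piece.bot : Piece → List Bool
  | .cup _ => []
  | .cap s => [s, !s]
  | .cross _ s t => [s, t]

/-- The directions of the strands at the top of a piece, from left to right. -/
def Piece.top : Piece → List Bool
  | .cup s => [s, !s]
  | .cap _ => []
  | .cross _ s t => [t, s]

/-- A horizontal slice of a diagram: one elementary piece, with vertical strands of the directions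
listed in `left` to its left and in `right` to its right. -/
structure Slice : Type where
  left : List Bool
  piece : Piece
  right : List Bool

/-- The directions of all strands at the bottom of a slice. -/
def Slice.bot (x : Slice) : List Bool := x.left ++ x.piece.bot ++ x.right

/-- The directions of all strands at the top of a slice. -/
def Slice.top (x : Slice) : List Bool := x.left ++ x.piece.top ++ x.right

/-- `Fits w d w'`: the slices of `d` can be stacked on each other (the first one at the bottom) and
form a tangle diagram whose bottom end points are `w` and whose top end points are `w'`. -/
def Fits : List Bool → List Slice → List Bool → Prop
  | w, [], w' => w = w'
  | w, x :: d, w' => w = x.bot ∧ Fits x.top d w'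

/-- An oriented link diagram: a stack of slices without end points. -/
structure LinkDiagram : Type where
  slices : List Slice
  closed : Fits [] slices []

/-- The part of a diagram outside a rectangle: the slices `below` and `above` it, and the vertical
strands `left` and `right` of it. -/
structure Surrounding : Type where
  below : List Slice
  left : List Bool
  right : List Bool
  above : List Slice

/-- Put the tangle diagram `x` into the rectangle left free by the surrounding `c`. -/
def Surrounding.fill (c : Surrounding) (x : List Slice) : List Slice :=
  c.below ++ x.map (fun y => ⟨c.left ++ y.left, y.piece, y.right ++ c.right⟩) ++ c.above

/-- The local moves: planar isotopies of diagrams (`exchange`, `zigzag`, `slide`) and the three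
Reidemeister moves, with all possible orientations of the strands. -/
inductive LocalMove : List Slice → List Slice → Prop
  /-- Two pieces that lie next to each other may be shifted past each other vertically. -/
  | exchange (p q : Piece) (m : List Bool) :
      LocalMove [⟨[], p, m ++ q.bot⟩, ⟨p.top ++ m, q, []⟩]
        [⟨p.bot ++ m, q, []⟩, ⟨[], p, m ++ q.top⟩]
  /-- A local minimum followed by a local maximum to its right is straightened. -/
  | zigzag_right (s : Bool) :
      LocalMove [⟨[], .cup s, [s]⟩, ⟨[s], .cap (!s), []⟩] []
  /-- A local minimum followed by a local maximum to its left is straightened. -/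
  | zigzag_left (s : Bool) :
      LocalMove [⟨[s], .cup (!s), []⟩, ⟨[], .cap s, [s]⟩] []
  /-- A strand that crosses one leg of a local maximum is moved to the other leg. -/
  | slide_cap (o s t : Bool) :
      LocalMove [⟨[s], .cross o t (!s), []⟩, ⟨[], .cap s, [t]⟩]
        [⟨[], .cross (!o) s t, [!s]⟩, ⟨[t], .cap s, []⟩]
  /-- A strand that crosses one leg of a local minimum is moved to the other leg. -/
  | slide_cup (o s t : Bool) :
      LocalMove [⟨[], .cup s, [t]⟩, ⟨[s], .cross o (!s) t, []⟩]
        [⟨[t], .cup s, []⟩, ⟨[], .cross (!o) t s, [!s]⟩]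
  /-- First Reidemeister move, curl on the right. -/
  | reidemeister1_right (o s : Bool) :
      LocalMove [⟨[s], .cup s, []⟩, ⟨[], .cross o s s, [!s]⟩, ⟨[s], .cap s, []⟩] []
  /-- First Reidemeister move, curl on the left. -/
  | reidemeister1_left (o s : Bool) :
      LocalMove [⟨[], .cup (!s), [s]⟩, ⟨[!s], .cross o s s, []⟩, ⟨[], .cap (!s), [s]⟩] []
  /-- Second Reidemeister move. -/
  | reidemeister2 (o s t : Bool) :
      LocalMove [⟨[], .cross o s t, []⟩, ⟨[], .cross (!o) t s, []⟩] []
  /-- Third Reidemeister move. -/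
  | reidemeister3 (o s t v : Bool) :
      LocalMove
        [⟨[], .cross o s t, [v]⟩, ⟨[t], .cross o s v, []⟩, ⟨[], .cross o t v, [s]⟩]
        [⟨[s], .cross o t v, []⟩, ⟨[], .cross o s v, [t]⟩, ⟨[v], .cross o s t, []⟩]

/-- Two link diagrams differ by one local move: they are identical outside a rectangle, and inside
it they are the two sides of the move. -/
def LinkDiagram.Move (D E : LinkDiagram) : Prop :=
  ∃ (c : Surrounding) (x y : List Slice),
    LocalMove x y ∧ D.slices = c.fill x ∧ E.slices = c.fill y

/-- Oriented links (up to isotopy): diagrams modulo planar isotopy and Reidemeister moves. -/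
def OrientedLink : Type := Quot LinkDiagram.Move

/-- The oriented link represented by a diagram. -/
def LinkDiagram.link (D : LinkDiagram) : OrientedLink := Quot.mk _ D

/-- The standard diagram of the trivial knot: a circle. -/
def trivialKnot : LinkDiagram where
  slices := [⟨[], .cup true, []⟩, ⟨[], .cap true, []⟩]
  closed := by simp [Fits, Slice.bot, Slice.top, Piece.bot, Piece.top]

/-! ### The Jones-Conway polynomial -/

/-- The ring `ℤ[a, a⁻¹, z, z⁻¹]`, as Laurent polynomials in `z` over Laurent polynomials in `a`. -/
abbrev LaurentAZ : Type := ℤ[T;T⁻¹][T;T⁻¹]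

namespace LaurentAZ

/-- The variable `a`. -/
noncomputable def a : LaurentAZ := LaurentPolynomial.C (LaurentPolynomial.T 1)

/-- The inverse `a⁻¹` of the variable `a`. -/
noncomputable def aInv : LaurentAZ := LaurentPolynomial.C (LaurentPolynomial.T (-1))

/-- The variable `z`. -/
noncomputable def z : LaurentAZ := LaurentPolynomial.T 1

theorem a_mul_aInv : a * aInv = 1 := by
  simp only [a, aInv, ← map_mul, ← LaurentPolynomial.T_add]
  simp

end LaurentAZ

/-- The properties describing the Jones-Conway polynomial: an isotopy invariant `P` of oriented
links with values in `ℤ[a, a⁻¹, z, z⁻¹]`, equal to `1` on the trivial knot, such that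
`a P(L₊) + a⁻¹ P(L₋) = z P(L₀)` whenever `L₊`, `L₋`, `L₀` have diagrams that are identical outside
a rectangle, inside which there are a positive crossing, a negative crossing, and two parallel
uncrossed strands, all strands being directed upwards. -/
structure IsJonesConway (P : OrientedLink → LaurentAZ) : Prop where
  trivial_knot : P trivialKnot.link = 1
  skein (c : Surrounding) (Dpos Dneg Dzero : LinkDiagram)
    (hpos : Dpos.slices = c.fill [⟨[], .cross true true true, []⟩])
    (hneg : Dneg.slices = c.fill [⟨[], .cross false true true, []⟩])
    (hzero : Dzero.slices = c.fill []) :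
    LaurentAZ.a * P Dpos.link + LaurentAZ.aInv * P Dneg.link = LaurentAZ.z * P Dzero.link

open Classical in
/-- The Jones-Conway polynomial: the invariant with the properties `IsJonesConway`. (By the theorem
of Freyd, Yetter, Hoste, Lickorish, Millett, Ocneanu, Przytycki and Traczyk it exists, and these
properties determine it on all nonempty links.) -/
noncomputable def jonesConway : OrientedLink → LaurentAZ :=
  if h : ∃ P, IsJonesConway P then h.choose else 0

/-! ### Twists -/

/-- `n` half twists of two vertical strands that have the directions `s`, `t` at the bottom: in
each crossing the strand going from the bottom left to the top right is the overpass. (These are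
positive crossings if the strands are parallel, and negative ones if they are antiparallel.) -/
def halfTwists : ℕ → Bool → Bool → List Slice
  | 0, _, _ => []
  | n + 1, s, t => ⟨[], .cross true s t, []⟩ :: halfTwists n t s

/-- The tangle consisting of a local maximum and, above it, a local minimum, with the end points of
two antiparallel vertical strands of directions `s`, `!s`. -/
def inftyTangle (s : Bool) : List Slice := [⟨[], .cap s, []⟩, ⟨[], .cup s, []⟩]

/-- `u1 k` is the polynomial `u₁^{(2k)}(a)`. -/
noncomputable def u1 : ℕ → LaurentAZ
  | 0 => 0
  | k + 1 => -LaurentAZ.a ^ 2 * u1 k + LaurentAZ.a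

/-! Apply the skein relation to the lowest of the `2k + 2` crossings. Switching it makes it cancel
against the next crossing by a second Reidemeister move, leaving `2k` half twists. Smoothing it
leaves a local maximum below a local minimum whose legs carry the other `2k + 1` half twists, and
these are undone by first Reidemeister moves (`skeinTriple_halfTwists`). So `a P(2k) + a⁻¹ P(2k+2) =
z P(∞)`, which yields the formula by induction on `k`, with exactly the recursion of `u1`.

The skein relation is given for upward strands only. A crossing of antiparallel strands is brought
to that form by a quarter turn (`rotate_crossing_left`, `rotate_crossing_right`), which gives
`SkeinTriple.antiparallel`. -/

/-! ### Isotopy of tangle diagrams -/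

/-- Put vertical strands to the left and to the right of a tangle diagram. -/
def widen (l r : List Bool) (x : List Slice) : List Slice :=
  x.map (fun y => ⟨l ++ y.left, y.piece, y.right ++ r⟩)

theorem widen_append (l r : List Bool) (x y : List Slice) :
    widen l r (x ++ y) = widen l r x ++ widen l r y := List.map_append

theorem widen_widen (l r l' r' : List Bool) (x : List Slice) :
    widen l r (widen l' r' x) = widen (l ++ l') (r' ++ r) x := by
  simp [widen, Function.comp_def]

theorem Surrounding.fill_eq (c : Surrounding) (x : List Slice) :
    c.fill x = c.below ++ widen c.left c.right x ++ c.above := rfl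

theorem fits_append {w w' : List Bool} {x y : List Slice} :
    Fits w (x ++ y) w' ↔ ∃ v, Fits w x v ∧ Fits v y w' := by
  induction x generalizing w with
  | nil => simp [Fits]
  | cons a x ih => simp [Fits, ih, and_assoc]

theorem Fits.append {u v w : List Bool} {x y : List Slice} (hx : Fits u x v) (hy : Fits v y w) :
    Fits u (x ++ y) w := fits_append.2 ⟨v, hx, hy⟩

theorem Fits.widen {w w' : List Bool} {x : List Slice} (l r : List Bool) (h : Fits w x w') :
    Fits (l ++ w ++ r) (widen l r x) (l ++ w' ++ r) := by
  induction x generalizing w with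
  | nil => cases h; rfl
  | cons a x ih =>
    obtain ⟨rfl, h⟩ := h
    refine ⟨by simp [Slice.bot], ?_⟩
    have := ih h
    simpa [_root_.widen, Slice.top] using this

/-- The rectangle left free by `c` has the end points `w` at its bottom and `w'` at its top. -/
structure Surrounding.Bounds (c : Surrounding) (w w' : List Bool) : Prop where
  below : Fits [] c.below (c.left ++ w ++ c.right)
  above : Fits (c.left ++ w' ++ c.right) c.above []

theorem Surrounding.Bounds.closed {c : Surrounding} {w w' : List Bool} (h : c.Bounds w w')
    {x : List Slice} (hx : Fits w x w') : Fits [] (c.fill x) [] :=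
  (h.below.append (hx.widen _ _)).append h.above

/-- The link diagram obtained by filling a rectangle with a tangle diagram. -/
def Surrounding.Bounds.diagram {c : Surrounding} {w w' : List Bool} (h : c.Bounds w w')
    {x : List Slice} (hx : Fits w x w') : LinkDiagram := ⟨c.fill x, h.closed hx⟩

/-- Closedness is a proposition, so regrouping the slices between a tangle and its surrounding does
not change the diagram. -/
theorem LinkDiagram.eq_of_slices {D E : LinkDiagram} (h : D.slices = E.slices) : D = E := by
  cases D; cases E; cases h; rfl

/-- Two tangle diagrams with bottom end points `w` and top end points `w'` that represent the same
link in every surrounding. -/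
structure TangleIsotopic (w w' : List Bool) (x y : List Slice) : Prop where
  fits_left : Fits w x w'
  fits_right : Fits w y w'
  link_eq : ∀ (c : Surrounding) (h : c.Bounds w w'),
    (h.diagram fits_left).link = (h.diagram fits_right).link

namespace TangleIsotopic

variable {u v w : List Bool} {x y t : List Slice}

theorem refl (h : Fits v x w) : TangleIsotopic v w x x := ⟨h, h, fun _ _ => rfl⟩

theorem symm (h : TangleIsotopic v w x y) : TangleIsotopic v w y x :=
  ⟨h.fits_right, h.fits_left, fun c hc => (h.link_eq c hc).symm⟩

theorem trans (h : TangleIsotopic v w x y) (h' : TangleIsotopic v w y t) :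
    TangleIsotopic v w x t :=
  ⟨h.fits_left, h'.fits_right, fun c hc => (h.link_eq c hc).trans (h'.link_eq c hc)⟩

theorem of_localMove (h : LocalMove x y) (hx : Fits v x w) (hy : Fits v y w) :
    TangleIsotopic v w x y :=
  ⟨hx, hy, fun c _ => Quot.sound ⟨c, x, y, h, rfl, rfl⟩⟩

theorem append_right (h : TangleIsotopic u v x y) (ht : Fits v t w) :
    TangleIsotopic u w (x ++ t) (y ++ t) := by
  refine ⟨h.fits_left.append ht, h.fits_right.append ht, fun c hc => ?_⟩
  -- The surrounding absorbs `t`, leaving a rectangle that contains only `x` or `y`.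
  have := h.link_eq ⟨c.below, c.left, c.right, widen c.left c.right t ++ c.above⟩
    ⟨hc.below, (ht.widen _ _).append hc.above⟩
  convert this using 2 <;>
    exact LinkDiagram.eq_of_slices
      (by simp [Surrounding.Bounds.diagram, Surrounding.fill_eq, widen_append])

theorem append_left (ht : Fits u t v) (h : TangleIsotopic v w x y) :
    TangleIsotopic u w (t ++ x) (t ++ y) := by
  refine ⟨ht.append h.fits_left, ht.append h.fits_right, fun c hc => ?_⟩
  have := h.link_eq ⟨c.below ++ widen c.left c.right t, c.left, c.right, c.above⟩
    ⟨hc.below.append (ht.widen _ _), hc.above⟩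
  convert this using 2 <;>
    exact LinkDiagram.eq_of_slices
      (by simp [Surrounding.Bounds.diagram, Surrounding.fill_eq, widen_append])

theorem widen (l r : List Bool) (h : TangleIsotopic v w x y) :
    TangleIsotopic (l ++ v ++ r) (l ++ w ++ r) (widen l r x) (widen l r y) := by
  refine ⟨h.fits_left.widen l r, h.fits_right.widen l r, fun c hc => ?_⟩
  have := h.link_eq ⟨c.below, c.left ++ l, r ++ c.right, c.above⟩
    ⟨by simpa using hc.below, by simpa using hc.above⟩
  convert this using 2 <;>
    exact LinkDiagram.eq_of_slices
      (by simp [Surrounding.Bounds.diagram, Surrounding.fill_eq, widen_widen])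

end TangleIsotopic

/-! ### Antiparallel crossings -/

/-- A crossing is rotated clockwise by sliding it over a local minimum added on its left. -/
theorem rotate_crossing_left (o s t : Bool) :
    TangleIsotopic [t, s] [s, t]
      [⟨[], .cup s, [t, s]⟩, ⟨[s], .cross o (!s) t, [s]⟩, ⟨[s, t], .cap (!s), []⟩]
      [⟨[], .cross (!o) t s, []⟩] := by
  have h₁ : TangleIsotopic [t, s] [s, t]
      [⟨[], .cup s, [t, s]⟩, ⟨[s], .cross o (!s) t, [s]⟩, ⟨[s, t], .cap (!s), []⟩]
      [⟨[t], .cup s, [s]⟩, ⟨[], .cross (!o) t s, [!s, s]⟩, ⟨[s, t], .cap (!s), []⟩] :=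
    ((TangleIsotopic.of_localMove (v := [t]) (w := [s, t, !s]) (.slide_cup o s t)
      (by simp [Fits, Slice.bot, Slice.top, Piece.bot, Piece.top])
      (by simp [Fits, Slice.bot, Slice.top, Piece.bot, Piece.top])).widen [] [s]).append_right
      (t := [⟨[s, t], .cap (!s), []⟩])
      (by simp [Fits, Slice.bot, Slice.top, Piece.bot, Piece.top])
  -- The local maximum is shifted below the crossing, where it forms a zigzag with the local
  -- minimum.
  have h₂ : TangleIsotopic [t, s] [s, t]
      [⟨[t], .cup s, [s]⟩, ⟨[], .cross (!o) t s, [!s, s]⟩, ⟨[s, t], .cap (!s), []⟩]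
      [⟨[t], .cup s, [s]⟩, ⟨[t, s], .cap (!s), []⟩, ⟨[], .cross (!o) t s, []⟩] :=
    TangleIsotopic.append_left (t := [⟨[t], .cup s, [s]⟩]) (v := [t, s, !s, s])
      (by simp [Fits, Slice.bot, Slice.top, Piece.bot, Piece.top])
      (by
        have h := LocalMove.exchange (.cross (!o) t s) (.cap (!s)) []
        simp only [Piece.bot, Piece.top, Bool.not_not, List.nil_append, List.append_nil] at h
        exact .of_localMove h
          (by simp [Fits, Slice.bot, Slice.top, Piece.bot, Piece.top])
          (by simp [Fits, Slice.bot, Slice.top, Piece.bot, Piece.top]))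
  have h₃ : TangleIsotopic [t, s] [s, t]
      [⟨[t], .cup s, [s]⟩, ⟨[t, s], .cap (!s), []⟩, ⟨[], .cross (!o) t s, []⟩]
      [⟨[], .cross (!o) t s, []⟩] :=
    ((TangleIsotopic.of_localMove (v := [s]) (w := [s]) (.zigzag_right s)
      (by simp [Fits, Slice.bot, Slice.top, Piece.bot, Piece.top])
      (by simp [Fits])).widen [t] []).append_right (t := [⟨[], .cross (!o) t s, []⟩])
      (by simp [Fits, Slice.bot, Slice.top, Piece.bot, Piece.top])
  exact (h₁.trans h₂).trans h₃

/-- A crossing is rotated by sliding it under a local maximum added on its left. -/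
theorem rotate_crossing_right (o s t : Bool) :
    TangleIsotopic [s, t] [t, s]
      [⟨[s, t], .cup (!s), []⟩, ⟨[s], .cross o t (!s), [s]⟩, ⟨[], .cap s, [t, s]⟩]
      [⟨[], .cross (!o) s t, []⟩] := by
  have h₁ : TangleIsotopic [s, t] [t, s]
      [⟨[s, t], .cup (!s), []⟩, ⟨[s], .cross o t (!s), [s]⟩, ⟨[], .cap s, [t, s]⟩]
      [⟨[s, t], .cup (!s), []⟩, ⟨[], .cross (!o) s t, [!s, s]⟩, ⟨[t], .cap s, [s]⟩] :=
    TangleIsotopic.append_left (t := [⟨[s, t], .cup (!s), []⟩])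
      (by simp [Fits, Slice.bot, Slice.top, Piece.bot, Piece.top])
      ((TangleIsotopic.of_localMove (v := [s, t, !s]) (w := [t]) (.slide_cap o s t)
        (by simp [Fits, Slice.bot, Slice.top, Piece.bot, Piece.top])
        (by simp [Fits, Slice.bot, Slice.top, Piece.bot, Piece.top])).widen [] [s])
  have h₂ : TangleIsotopic [s, t] [t, s]
      [⟨[s, t], .cup (!s), []⟩, ⟨[], .cross (!o) s t, [!s, s]⟩, ⟨[t], .cap s, [s]⟩]
      [⟨[], .cross (!o) s t, []⟩, ⟨[t, s], .cup (!s), []⟩, ⟨[t], .cap s, [s]⟩] :=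
    TangleIsotopic.append_right (u := [s, t]) (w := [t, s]) (t := [⟨[t], .cap s, [s]⟩]) (v := [t, s, !s, s])
      (by
        have h := LocalMove.exchange (.cross (!o) s t) (.cup (!s)) []
        simp only [Piece.bot, Piece.top, Bool.not_not, List.nil_append, List.append_nil] at h
        exact (TangleIsotopic.of_localMove h
          (by simp [Fits, Slice.bot, Slice.top, Piece.bot, Piece.top])
          (by simp [Fits, Slice.bot, Slice.top, Piece.bot, Piece.top])).symm)
      (by simp [Fits, Slice.bot, Slice.top, Piece.bot, Piece.top])
  have h₃ : TangleIsotopic [s, t] [t, s]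
      [⟨[], .cross (!o) s t, []⟩, ⟨[t, s], .cup (!s), []⟩, ⟨[t], .cap s, [s]⟩]
      [⟨[], .cross (!o) s t, []⟩] :=
    TangleIsotopic.append_left (t := [⟨[], .cross (!o) s t, []⟩])
      (by simp [Fits, Slice.bot, Slice.top, Piece.bot, Piece.top])
      ((TangleIsotopic.of_localMove (v := [s]) (w := [s]) (.zigzag_left s)
        (by simp [Fits, Slice.bot, Slice.top, Piece.bot, Piece.top])
        (by simp [Fits])).widen [t] [])
  exact (h₁.trans h₂).trans h₃

/-- A half twist of the legs of a local minimum is undone by a first Reidemeister move. -/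
theorem cup_cross_isotopic (o s : Bool) :
    TangleIsotopic [] [!s, s] [⟨[], .cup s, []⟩, ⟨[], .cross o s (!s), []⟩]
      [⟨[], .cup (!s), []⟩] := by
  -- The first Reidemeister moves need a crossing `cross o s s`, so this one is turned first. The
  -- minimum added by the turn survives; the original one becomes part of the curl.
  have h₁ : TangleIsotopic [] [!s, s] [⟨[], .cup s, []⟩, ⟨[], .cross o s (!s), []⟩]
      [⟨[], .cup s, []⟩, ⟨[], .cup (!s), [s, !s]⟩, ⟨[!s], .cross (!o) s s, [!s]⟩,
        ⟨[!s, s], .cap s, []⟩] :=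
    TangleIsotopic.append_left (t := [⟨[], .cup s, []⟩]) (v := [s, !s])
      (by simp [Fits, Slice.bot, Slice.top, Piece.bot, Piece.top])
      (by simpa using (rotate_crossing_left (!o) (!s) s).symm)
  have h₂ : TangleIsotopic [] [!s, s]
      [⟨[], .cup s, []⟩, ⟨[], .cup (!s), [s, !s]⟩, ⟨[!s], .cross (!o) s s, [!s]⟩,
        ⟨[!s, s], .cap s, []⟩]
      [⟨[], .cup (!s), []⟩, ⟨[!s, s], .cup s, []⟩, ⟨[!s], .cross (!o) s s, [!s]⟩,
        ⟨[!s, s], .cap s, []⟩] :=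
    TangleIsotopic.append_right (u := []) (w := [!s, s]) (v := [!s, s, s, !s])
      (t := [⟨[!s], .cross (!o) s s, [!s]⟩, ⟨[!s, s], .cap s, []⟩])
      (by
        have h := LocalMove.exchange (.cup (!s)) (.cup s) []
        simp only [Piece.bot, Piece.top, Bool.not_not, List.nil_append, List.append_nil] at h
        exact (TangleIsotopic.of_localMove h
          (by simp [Fits, Slice.bot, Slice.top, Piece.bot, Piece.top])
          (by simp [Fits, Slice.bot, Slice.top, Piece.bot, Piece.top])).symm)
      (by simp [Fits, Slice.bot, Slice.top, Piece.bot, Piece.top])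
  have h₃ : TangleIsotopic [] [!s, s]
      [⟨[], .cup (!s), []⟩, ⟨[!s, s], .cup s, []⟩, ⟨[!s], .cross (!o) s s, [!s]⟩,
        ⟨[!s, s], .cap s, []⟩] [⟨[], .cup (!s), []⟩] :=
    TangleIsotopic.append_left (t := [⟨[], .cup (!s), []⟩]) (v := [!s, s])
      (by simp [Fits, Slice.bot, Slice.top, Piece.bot, Piece.top])
      ((TangleIsotopic.of_localMove (v := [s]) (w := [s]) (.reidemeister1_right (!o) s)
        (by simp [Fits, Slice.bot, Slice.top, Piece.bot, Piece.top])
        (by simp [Fits])).widen [!s] [])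
  exact (h₁.trans h₂).trans h₃

/-- Evenness matters: each half twist exchanges the two directions. -/
theorem fits_halfTwists_even (k : ℕ) (s t : Bool) : Fits [s, t] (halfTwists (2 * k) s t) [s, t] := by
  induction k with
  | zero => rfl
  | succ k ih => exact ⟨rfl, rfl, ih⟩

/-- An even number of half twists of the legs of a local minimum is undone. -/
theorem cup_halfTwists_isotopic (k : ℕ) (s : Bool) :
    TangleIsotopic [] [s, !s] (⟨[], .cup s, []⟩ :: halfTwists (2 * k) s (!s))
      [⟨[], .cup s, []⟩] := by
  induction k with
  | zero => exact .refl ⟨rfl, rfl⟩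
  | succ k ih =>
    have h₁ : TangleIsotopic [] [s, !s]
        (⟨[], .cup s, []⟩ :: halfTwists (2 * (k + 1)) s (!s))
        (⟨[], .cup (!s), []⟩ :: ⟨[], .cross true (!s) s, []⟩ :: halfTwists (2 * k) s (!s)) :=
      (cup_cross_isotopic true s).append_right
        (t := ⟨[], .cross true (!s) s, []⟩ :: halfTwists (2 * k) s (!s))
        ⟨rfl, fits_halfTwists_even k s (!s)⟩
    have h₂ : TangleIsotopic [] [s, !s]
        (⟨[], .cup (!s), []⟩ :: ⟨[], .cross true (!s) s, []⟩ :: halfTwists (2 * k) s (!s))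
        (⟨[], .cup s, []⟩ :: halfTwists (2 * k) s (!s)) := by
      have h := cup_cross_isotopic true (!s)
      simp only [Bool.not_not] at h
      exact h.append_right (fits_halfTwists_even k s (!s))
    exact (h₁.trans h₂).trans ih

/-! ### Skein relations -/

/-- The skein relation of the Jones-Conway polynomial. -/
def SatisfiesSkein (P : OrientedLink → LaurentAZ) : Prop :=
  ∀ (c : Surrounding) (Dpos Dneg Dzero : LinkDiagram),
    Dpos.slices = c.fill [⟨[], .cross true true true, []⟩] →
    Dneg.slices = c.fill [⟨[], .cross false true true, []⟩] →
    Dzero.slices = c.fill [] →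
    LaurentAZ.a * P Dpos.link + LaurentAZ.aInv * P Dneg.link = LaurentAZ.z * P Dzero.link

/-- The existence theorem is not needed: the default value `0` satisfies the skein relation too, and
the normalization on the trivial knot plays no role in the twist formula. -/
theorem jonesConway_satisfiesSkein : SatisfiesSkein jonesConway := by
  unfold jonesConway
  split_ifs with h
  · exact h.choose_spec.skein
  · intro c Dpos Dneg Dzero _ _ _
    simp

/-- The skein relation for three tangles with the end points `w` and `w'`. -/
structure SkeinTriple (P : OrientedLink → LaurentAZ) (w w' : List Bool)
    (pos neg zero : List Slice) : Prop where
  fits_pos : Fits w pos w'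
  fits_neg : Fits w neg w'
  fits_zero : Fits w zero w'
  eq : ∀ (c : Surrounding) (h : c.Bounds w w'),
    LaurentAZ.a * P (h.diagram fits_pos).link + LaurentAZ.aInv * P (h.diagram fits_neg).link
      = LaurentAZ.z * P (h.diagram fits_zero).link

namespace SkeinTriple

variable {P : OrientedLink → LaurentAZ} {u v w : List Bool} {x y t x' y' t' : List Slice}

theorem congr (h : SkeinTriple P v w x y t) (hx : TangleIsotopic v w x x')
    (hy : TangleIsotopic v w y y') (ht : TangleIsotopic v w t t') :
    SkeinTriple P v w x' y' t' :=
  ⟨hx.fits_right, hy.fits_right, ht.fits_right, fun c hc => by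
    rw [← hx.link_eq c hc, ← hy.link_eq c hc, ← ht.link_eq c hc]
    exact h.eq c hc⟩

theorem append_right (h : SkeinTriple P u v x y t) {b : List Slice} (hb : Fits v b w) :
    SkeinTriple P u w (x ++ b) (y ++ b) (t ++ b) := by
  refine ⟨h.fits_pos.append hb, h.fits_neg.append hb, h.fits_zero.append hb, fun c hc => ?_⟩
  have hc' : Surrounding.Bounds ⟨c.below, c.left, c.right, widen c.left c.right b ++ c.above⟩ u v :=
    ⟨hc.below, (hb.widen _ _).append hc.above⟩
  have hd {x : List Slice} (hx : Fits u x v) : hc.diagram (hx.append hb) = hc'.diagram hx :=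
    LinkDiagram.eq_of_slices
      (by simp [Surrounding.Bounds.diagram, Surrounding.fill_eq, widen_append])
  rw [hd h.fits_pos, hd h.fits_neg, hd h.fits_zero]
  exact h.eq _ hc'

/-- The skein relation at a crossing of upward strands inside a tangle diagram. -/
theorem of_satisfiesSkein (hP : SatisfiesSkein P) {b b' : List Slice} {l r : List Bool}
    (hb : Fits u b (l ++ [true, true] ++ r)) (hb' : Fits (l ++ [true, true] ++ r) b' w) :
    SkeinTriple P u w (b ++ [⟨l, .cross true true true, r⟩] ++ b')
      (b ++ [⟨l, .cross false true true, r⟩] ++ b') (b ++ b') := by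
  have hcross (o : Bool) : Fits (l ++ [true, true] ++ r) [⟨l, .cross o true true, r⟩]
      (l ++ [true, true] ++ r) := ⟨rfl, rfl⟩
  refine ⟨(hb.append (hcross true)).append hb', (hb.append (hcross false)).append hb',
    hb.append hb', fun c hc => ?_⟩
  refine hP ⟨c.below ++ widen c.left c.right b, c.left ++ l, r ++ c.right,
    widen c.left c.right b' ++ c.above⟩ _ _ _ ?_ ?_ ?_ <;>
    simp [Surrounding.Bounds.diagram, Surrounding.fill_eq, widen]

/-- The skein relation at a crossing of two antiparallel vertical strands. -/
theorem antiparallel (hP : SatisfiesSkein P) (s : Bool) :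
    SkeinTriple P [s, !s] [!s, s] [⟨[], .cross false s (!s), []⟩] [⟨[], .cross true s (!s), []⟩]
      [⟨[], .cap s, []⟩, ⟨[], .cup (!s), []⟩] := by
  cases s
  · refine (of_satisfiesSkein hP (b := [⟨[false, true], .cup true, []⟩])
      (b' := [⟨[], .cap false, [true, false]⟩]) (l := [false]) (r := [false])
      ⟨rfl, rfl⟩ ⟨rfl, rfl⟩).congr (rotate_crossing_right true false true)
      (rotate_crossing_right false false true) ?_
    -- Without the crossing, the added minimum and maximum lie side by side and can be reordered.
    exact (TangleIsotopic.of_localMove (.exchange (.cap false) (.cup true) [])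
      ⟨rfl, rfl, rfl⟩ ⟨rfl, rfl, rfl⟩).symm
  · refine (of_satisfiesSkein hP (b := [⟨[], .cup false, [true, false]⟩])
      (b' := [⟨[false, true], .cap true, []⟩]) (l := [false]) (r := [false])
      ⟨rfl, rfl⟩ ⟨rfl, rfl⟩).congr (rotate_crossing_left true false true)
      (rotate_crossing_left false false true) ?_
    exact .of_localMove (.exchange (.cup false) (.cap true) [])
      ⟨rfl, rfl, rfl⟩ ⟨rfl, rfl, rfl⟩

end SkeinTriple

/-! ### Twists of antiparallel strands -/

theorem fits_inftyTangle (s : Bool) : Fits [s, !s] (inftyTangle s) [s, !s] := ⟨rfl, rfl, rfl⟩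

/-- The skein relation at the first crossing of `2k + 2` antiparallel half twists. -/
theorem skeinTriple_halfTwists {P : OrientedLink → LaurentAZ} (hP : SatisfiesSkein P) (k : ℕ)
    (s : Bool) :
    SkeinTriple P [s, !s] [s, !s] (halfTwists (2 * k) s (!s)) (halfTwists (2 * (k + 1)) s (!s))
      (inftyTangle s) := by
  refine ((SkeinTriple.antiparallel hP s).append_right (w := [s, !s])
    (b := ⟨[], .cross true (!s) s, []⟩ :: halfTwists (2 * k) s (!s))
    ⟨rfl, fits_halfTwists_even k s (!s)⟩).congr ?_ (.refl ?_) ?_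
  · exact (TangleIsotopic.of_localMove (v := [s, !s]) (w := [s, !s])
      (.reidemeister2 false s (!s)) ⟨rfl, rfl, rfl⟩ rfl).append_right
      (fits_halfTwists_even k s (!s))
  · exact ⟨rfl, rfl, fits_halfTwists_even k s (!s)⟩
  · refine .append_left (t := [⟨[], .cap s, []⟩]) (v := []) ⟨rfl, rfl⟩ ?_
    have h := cup_cross_isotopic true (!s)
    simp only [Bool.not_not] at h
    exact (h.append_right (fits_halfTwists_even k s (!s))).trans (cup_halfTwists_isotopic k s)

/-- The Jones-Conway polynomial of twisted antiparallel strands, in terms of the skein relation. -/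
theorem SatisfiesSkein.halfTwists {P : OrientedLink → LaurentAZ} (hP : SatisfiesSkein P) (s : Bool)
    {c : Surrounding} (hc : c.Bounds [s, !s] [s, !s]) (k : ℕ) :
    P (hc.diagram (fits_halfTwists_even k s (!s))).link
      = (-1) ^ k * LaurentAZ.a ^ (2 * k) * P (hc.diagram (x := []) (fits_halfTwists_even 0 s (!s))).link
        + LaurentAZ.z * u1 k * P (hc.diagram (fits_inftyTangle s)).link := by
  induction k with
  | zero => simp [u1, _root_.halfTwists]
  | succ k ih =>
    have h := (skeinTriple_halfTwists hP k s).eq c hc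
    rw [ih] at h
    rw [u1]
    -- Multiplying by `a` isolates the twisted term, whose coefficient becomes `a * aInv = 1`.
    linear_combination LaurentAZ.a * h
      - P (hc.diagram (fits_halfTwists_even (k + 1) s (!s))).link * LaurentAZ.a_mul_aInv

/-- The first crossing fixes the lower end points, and the slices then determine the upper ones. An
empty filling would fix nothing, hence `k + 1`. -/
theorem Surrounding.bounds_of_halfTwists {c : Surrounding} {k : ℕ} {s t : Bool}
    (h : Fits [] (c.fill (halfTwists (2 * (k + 1)) s t)) []) : c.Bounds [s, t] [s, t] := by
  rw [Surrounding.fill_eq, fits_append] at h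
  obtain ⟨w', h, habove⟩ := h
  obtain ⟨w, hbelow, h⟩ := fits_append.1 h
  have hw : w = c.left ++ [s, t] ++ c.right := by
    simpa [Slice.bot, Piece.bot] using h.1
  subst hw
  have unique : ∀ {x : List Slice} {u v v' : List Bool}, Fits u x v → Fits u x v' → v = v' := by
    intro x
    induction x with
    | nil => intro u v v' h h'; exact h.symm.trans h'
    | cons a x ih => intro u v v' h h'; exact ih h.2 h'.2
  have hw' := unique h ((fits_halfTwists_even (k + 1) s t).widen c.left c.right)
  subst hw'
  exact ⟨hbelow, habove⟩

theorem SatisfiesSkein.twist_formula {P : OrientedLink → LaurentAZ} (hP : SatisfiesSkein P)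
    (k : ℕ) (s : Bool) (c : Surrounding) (Dtwist Dzero Dinfty : LinkDiagram)
    (htwist : Dtwist.slices = c.fill (_root_.halfTwists (2 * k) s (!s)))
    (hzero : Dzero.slices = c.fill []) (hinfty : Dinfty.slices = c.fill (inftyTangle s)) :
    P Dtwist.link = (-1) ^ k * LaurentAZ.a ^ (2 * k) * P Dzero.link
      + LaurentAZ.z * u1 k * P Dinfty.link := by
  cases k with
  | zero =>
    rw [LinkDiagram.eq_of_slices (htwist.trans hzero.symm)]
    simp [u1]
  | succ k =>
    have hc : c.Bounds [s, !s] [s, !s] := Surrounding.bounds_of_halfTwists (htwist ▸ Dtwist.closed)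
    have h := hP.halfTwists s hc (k + 1)
    rwa [← LinkDiagram.eq_of_slices (E := hc.diagram (fits_halfTwists_even (k + 1) s _)) htwist,
      ← LinkDiagram.eq_of_slices (E := hc.diagram (x := []) (fits_halfTwists_even 0 s _)) hzero,
      ← LinkDiagram.eq_of_slices (E := hc.diagram (fits_inftyTangle s)) hinfty] at h

/-! ### The closed form of the coefficients -/

theorem LaurentAZ.a_add_aInv_ne_zero : LaurentAZ.a + LaurentAZ.aInv ≠ 0 := by
  intro h
  rw [LaurentAZ.a, LaurentAZ.aInv, ← map_add] at h
  -- The coefficient of `z⁰a¹` is `1`.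
  have := congrArg (fun f : LaurentAZ => (f.coeff 0).coeff 1) h
  simp [LaurentPolynomial.T, ← LaurentPolynomial.single_eq_C, -LaurentPolynomial.single_eq_C_mul_T]
    at this

/-- The quotient is stated with its denominator cleared. The right side equals `1 + (-1)^(k+1)
a^(2k)`, and the recursion preserves this since `a (a + a⁻¹) = a² + 1`. -/
theorem u1_mul_a_add_aInv (k : ℕ) :
    u1 k * (LaurentAZ.a + LaurentAZ.aInv)
      = (-1) ^ (k + 1) * LaurentAZ.a ^ k *
          (LaurentAZ.a ^ k + (-1) ^ (k + 1) * LaurentAZ.aInv ^ k) := by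
  have inv (k : ℕ) : LaurentAZ.a ^ k * LaurentAZ.aInv ^ k = 1 := by
    rw [← mul_pow, LaurentAZ.a_mul_aInv, one_pow]
  have sign (k : ℕ) : ((-1 : LaurentAZ) ^ k) * (-1) ^ k = 1 := by
    rw [← mul_pow, show (-1 : LaurentAZ) * -1 = 1 by ring, one_pow]
  have key (k : ℕ) : (-1) ^ (k + 1) * LaurentAZ.a ^ k *
      (LaurentAZ.a ^ k + (-1) ^ (k + 1) * LaurentAZ.aInv ^ k)
      = (-1) ^ (k + 1) * LaurentAZ.a ^ (2 * k) + 1 := by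
    linear_combination (-1) ^ (k + 1) * (-1) ^ (k + 1) * inv k + sign (k + 1)
  rw [key]
  induction k with
  | zero => simp [u1]
  | succ k ih =>
    rw [u1]
    linear_combination -LaurentAZ.a ^ 2 * ih + LaurentAZ.a_mul_aInv

/-- The closed form determines the sequence because the nonzero factor `a + a⁻¹` can be cancelled.
-/
theorem eq_u1_iff (u : ℕ → LaurentAZ) :
    u = u1 ↔ ∀ k : ℕ,
      u k * (LaurentAZ.a + LaurentAZ.aInv)
        = (-1) ^ (k + 1) * LaurentAZ.a ^ k *
            (LaurentAZ.a ^ k + (-1) ^ (k + 1) * LaurentAZ.aInv ^ k) := by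
  refine ⟨fun h k => h ▸ u1_mul_a_add_aInv k, fun h => funext fun k => ?_⟩
  exact mul_right_cancel₀ LaurentAZ.a_add_aInv_ne_zero ((h k).trans (u1_mul_a_add_aInv k).symm)

theorem theorem1p7 :
    (∀ (k : ℕ) (s : Bool) (c : Surrounding) (Dtwist Dzero Dinfty : LinkDiagram),
      Dtwist.slices = c.fill (halfTwists (2 * k) s (!s)) →
      Dzero.slices = c.fill [] →
      Dinfty.slices = c.fill (inftyTangle s) →
      (∀ P : OrientedLink → LaurentAZ, IsJonesConway P →
        P Dtwist.link = (-1) ^ k * LaurentAZ.a ^ (2 * k) * P Dzero.link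
          + LaurentAZ.z * u1 k * P Dinfty.link) ∧
      jonesConway Dtwist.link = (-1) ^ k * LaurentAZ.a ^ (2 * k) * jonesConway Dzero.link
        + LaurentAZ.z * u1 k * jonesConway Dinfty.link) ∧
    u1 0 = 0 ∧ u1 1 = LaurentAZ.a ∧
    (∀ k : ℕ, u1 (k + 1) = -LaurentAZ.a ^ 2 * u1 k + LaurentAZ.a) ∧
    (∀ u : ℕ → LaurentAZ,
      u = u1 ↔ ∀ k : ℕ,
        u k * (LaurentAZ.a + LaurentAZ.aInv)
          = (-1) ^ (k + 1) * LaurentAZ.a ^ k *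
              (LaurentAZ.a ^ k + (-1) ^ (k + 1) * LaurentAZ.aInv ^ k)) := by
  refine ⟨fun k s c Dtwist Dzero Dinfty htwist hzero hinfty => ⟨fun P hP => ?_, ?_⟩, rfl,
    by simp [u1], fun _ => rfl, eq_u1_iff⟩
  · exact SatisfiesSkein.twist_formula hP.skein k s c _ _ _ htwist hzero hinfty
  · exact jonesConway_satisfiesSkein.twist_formula k s c _ _ _ htwist hzero hinfty
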